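/- Let $(X,d)$ be a proper, non-compact $\mathrm{CAT}(-1)$ space and let $\Gamma$ be a discrete (for the compact-open topology), cocompact subgroup of the group of isometries of $X$. Equip $X\times X$ with the maximum metric $d_{\max}((x,y),(x',y'))=\max\{d(x,x'),d(y,y')\}$. Let $C_*$ be the space of continuous functions $X\times X\to\mathbb{R}$ with the topology of uniform convergence on compact sets, modulo additive constants, embed $X\times X$ in $C_*$ by $\iota(p)=[d_{\max}(p,\cdot)]$, and let $\partial_\infty^{\max}(X\times X)=\overline{\iota(X\times X)}\setminus\iota(X\times X)$ be the horofunction boundary. The diagonal action of $\Gamma$ on $X\times X$ extends to $\partial_\infty^{\max}(X\times X)$ by $\gamma\cdot[h]=[h\circ\gamma^{-1}]$. For a geodesic ray $c:[0,\infty)\to X$ (an isometric embedding) let $\beta_c(z)=\lim_{t\to\infty}\bigl(d(z,c(t))-t\bigr)$ be its Busemann function and let $c(\infty)\in\partial_\infty X$ be its ideal endpoint, where two rays $c,c'$ have the same endpoint if and only if $d(c(t),c'(t))$ is bounded in $t$. Let $\Omega\subset\partial_\infty^{\max}(X\times X)$ be the $\Gamma$-invariant set of all boundary points represented by a function of the form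 $$(z,z')\mapsto\max\{\beta_c(z),\ \beta_{c'}(z')+C\},$$ where $C\in\mathbb{R}$ and $c,c'$ are rays in $X$ with $c(\infty)\neq c'(\infty)$, with the subspace topology. Then the action of $\Gamma$ on $\Omega$ is cocompact (there is a compact set $K\subset\Omega$ with $\Gamma K=\Omega$) and properly discontinuous (for all compact $K,L\subset\Omega$ the set $\gamma K\cap L$ is non-empty for only finitely many $\gamma\in\Gamma$). -/

import Mathlib

open Set Filter Topology

/-! ### `CAT(-1)` spaces -/

/-- `c`, restricted to `[0, d(p,q)]`, is a geodesic segment from `p` to `q`. -/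
structure IsGeodesicSegment {X : Type*} [MetricSpace X] (c : ℝ → X) (p q : X) : Prop where
  map_zero : c 0 = p
  map_dist : c (dist p q) = q
  dist_eq : ∀ s ∈ Icc (0 : ℝ) (dist p q), ∀ t ∈ Icc (0 : ℝ) (dist p q),
    dist (c s) (c t) = |s - t|

/-- `X` is a `CAT(-1)` space: a geodesic space whose geodesic triangles are at least as thin as
their comparison triangles in the hyperbolic plane (the upper half-plane, of curvature `-1`).
Two points on the same side of a triangle are at the same distance as their comparison points, so
only points on two different sides have to be compared; the common vertex of the two sides is
called `p`. -/
structure IsCATNegOne (X : Type*) [MetricSpace X] : Prop where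
  exists_segment : ∀ p q : X, ∃ c : ℝ → X, IsGeodesicSegment c p q
  comparison : ∀ (p q r : X) (c c' : ℝ → X),
    IsGeodesicSegment c p q → IsGeodesicSegment c' p r →
    ∀ (p₀ q₀ r₀ : UpperHalfPlane) (k k' : ℝ → UpperHalfPlane),
      dist p₀ q₀ = dist p q → dist p₀ r₀ = dist p r → dist q₀ r₀ = dist q r →
      IsGeodesicSegment k p₀ q₀ → IsGeodesicSegment k' p₀ r₀ →
      ∀ s ∈ Icc (0 : ℝ) (dist p q), ∀ t ∈ Icc (0 : ℝ) (dist p r),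
        dist (c s) (c' t) ≤ dist (k s) (k' t)

/-! ### Groups of isometries -/

/-- The isometry group of `X` acts on `X` by evaluation. -/
instance isometryEquivMulAction {X : Type*} [MetricSpace X] : MulAction (X ≃ᵢ X) X where
  smul γ x := γ x
  one_smul _ := rfl
  mul_smul _ _ _ := rfl

instance isometryEquivIsIsometricSMul {X : Type*} [MetricSpace X] :
    IsIsometricSMul (X ≃ᵢ X) X :=
  ⟨fun γ => γ.isometry⟩

/-- `Γ` is a discrete subgroup of the isometry group, the latter with the compact-open topology. -/
def IsDiscreteSubgroup {X : Type*} [MetricSpace X] (Γ : Subgroup (X ≃ᵢ X)) : Prop :=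
  @DiscreteTopology Γ (TopologicalSpace.induced
    (fun γ : Γ => (⟨fun x => (γ : X ≃ᵢ X) x, (γ : X ≃ᵢ X).continuous⟩ : C(X, X))) inferInstance)

/-- The action of `Γ` on `T` is cocompact: the translates of some compact set cover `T`. -/
def IsCocompactAction (Γ T : Type*) [TopologicalSpace T] [SMul Γ T] : Prop :=
  ∃ K : Set T, IsCompact K ∧ ∀ x : T, ∃ γ : Γ, ∃ y ∈ K, γ • y = x

/-! ### Rays and Busemann functions -/

/-- A geodesic ray: an isometric embedding of `[0, ∞)`. -/
structure GeodesicRay (X : Type*) [MetricSpace X] where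
  toFun : NNReal → X
  isometry_toFun : Isometry toFun

instance geodesicRayCoeFun {X : Type*} [MetricSpace X] :
    CoeFun (GeodesicRay X) (fun _ => NNReal → X) :=
  ⟨GeodesicRay.toFun⟩

/-- Two rays are asymptotic if they stay at bounded distance. -/
instance geodesicRaySetoid (X : Type*) [MetricSpace X] : Setoid (GeodesicRay X) where
  r c c' := ∃ C : ℝ, ∀ t : NNReal, dist (c t) (c' t) ≤ C
  iseqv :=
    { refl := fun c => ⟨0, fun t => by simp⟩
      symm := fun ⟨C, h⟩ => ⟨C, fun t => by rw [dist_comm]; exact h t⟩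
      trans := fun ⟨C, h⟩ ⟨C', h'⟩ =>
        ⟨C + C', fun t => (dist_triangle _ _ _).trans (add_le_add (h t) (h' t))⟩ }

/-- The ideal boundary of `X`: asymptote classes of rays. -/
def RayBoundary (X : Type*) [MetricSpace X] : Type _ := Quotient (geodesicRaySetoid X)

/-- The ideal endpoint of a ray. -/
def GeodesicRay.endpoint {X : Type*} [MetricSpace X] (c : GeodesicRay X) : RayBoundary X :=
  Quotient.mk (geodesicRaySetoid X) c

/-- The Busemann function `x ↦ lim_{t → ∞} d(x, c(t)) - t` of a ray `c`. -/
noncomputable def busemann {X : Type*} [MetricSpace X] (c : GeodesicRay X) (x : X) : ℝ :=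
  limUnder atTop (fun t : NNReal => dist x (c t) - (t : ℝ))

theorem tendsto_busemann {X : Type*} [MetricSpace X] (c : GeodesicRay X) (x : X) :
    Tendsto (fun t : NNReal => dist x (c t) - (t : ℝ)) atTop (𝓝 (busemann c x)) := by
  have key : ∀ s t : NNReal, dist (c s) (c t) = |(s : ℝ) - t| := fun s t => by
    rw [c.isometry_toFun.dist_eq, NNReal.dist_eq]
  have hanti : Antitone (fun t : NNReal => dist x (c t) - (t : ℝ)) := by
    intro s t hst
    have h1 := dist_triangle x (c s) (c t)
    have h2 : (s : ℝ) ≤ t := by exact_mod_cast hst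
    rw [key, abs_sub_comm, abs_of_nonneg (by linarith)] at h1
    show dist x (c t) - (t : ℝ) ≤ dist x (c s) - (s : ℝ)
    linarith
  have hbdd : BddBelow (range (fun t : NNReal => dist x (c t) - (t : ℝ))) := by
    refine ⟨-dist (c 0) x, ?_⟩
    rintro _ ⟨t, rfl⟩
    have h1 := dist_triangle (c 0) x (c t)
    rw [key, abs_sub_comm] at h1
    simp only [NNReal.coe_zero, sub_zero, NNReal.abs_eq] at h1
    show -dist (c 0) x ≤ dist x (c t) - (t : ℝ)
    linarith
  exact tendsto_nhds_limUnder ⟨_, tendsto_atTop_ciInf hanti hbdd⟩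

theorem continuous_busemann {X : Type*} [MetricSpace X] (c : GeodesicRay X) :
    Continuous (busemann c) := by
  have hle : ∀ x y : X, busemann c x ≤ busemann c y + dist x y := fun x y =>
    le_of_tendsto_of_tendsto' (tendsto_busemann c x) ((tendsto_busemann c y).add_const _)
      (fun t => by linarith [dist_triangle x y (c t)])
  exact (LipschitzWith.of_le_add hle).continuous

/-! ### The horofunction boundary -/

/-- The constant functions. -/
def constFunctions (Y : Type*) [TopologicalSpace Y] : AddSubgroup C(Y, ℝ) where
  carrier := {f | ∃ a : ℝ, ∀ y, f y = a}
  zero_mem' := ⟨0, fun _ => rfl⟩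
  add_mem' := fun ⟨a, ha⟩ ⟨b, hb⟩ => ⟨a + b, fun y => by simp [ha y, hb y]⟩
  neg_mem' := fun ⟨a, ha⟩ => ⟨-a, fun y => by simp [ha y]⟩

/-- The space `C_*` of continuous real functions, with the topology of uniform convergence on
compact sets, modulo additive constants (with the quotient topology). -/
def FunModConst (Y : Type*) [TopologicalSpace Y] : Type _ := C(Y, ℝ) ⧸ constFunctions Y

instance funModConstTopologicalSpace (Y : Type*) [TopologicalSpace Y] :
    TopologicalSpace (FunModConst Y) :=
  inferInstanceAs (TopologicalSpace (C(Y, ℝ) ⧸ constFunctions Y))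

/-- The class of a function modulo constants. -/
def FunModConst.mk {Y : Type*} [TopologicalSpace Y] (f : C(Y, ℝ)) : FunModConst Y :=
  QuotientAddGroup.mk f

theorem FunModConst.mk_eq_mk {Y : Type*} [TopologicalSpace Y] {f g : C(Y, ℝ)} :
    FunModConst.mk f = FunModConst.mk g ↔ ∃ a : ℝ, ∀ y, g y = f y + a := by
  refine QuotientAddGroup.eq.trans ⟨?_, ?_⟩
  · rintro ⟨a, ha⟩
    refine ⟨a, fun y => ?_⟩
    have h : -f y + g y = a := ha y
    linarith
  · rintro ⟨a, ha⟩
    refine ⟨a, fun y => ?_⟩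
    show -f y + g y = a
    rw [ha y]
    ring

/-- The embedding `p ↦ [d(p, ·)]`. -/
noncomputable def distClass {Y : Type*} [MetricSpace Y] (p : Y) : FunModConst Y :=
  FunModConst.mk ⟨fun y => dist p y, continuous_const.dist continuous_id⟩

/-- The horofunction boundary of a metric space. -/
def horofunctionBoundary (Y : Type*) [MetricSpace Y] : Set (FunModConst Y) :=
  closure (range (distClass (Y := Y))) \ range (distClass (Y := Y))

/-- The action on classes of functions induced by an action on the space:
`γ • [f] = [f ∘ γ⁻¹]`. It extends the action on the space, since `γ • [d(p, ·)] = [d(γ p, ·)]`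
for isometries `γ`. -/
instance funModConstMulAction {G Y : Type*} [Group G] [TopologicalSpace Y] [MulAction G Y]
    [ContinuousConstSMul G Y] : MulAction G (FunModConst Y) where
  smul γ := Quotient.lift
    (fun f : C(Y, ℝ) => FunModConst.mk (f.comp ⟨fun y => γ⁻¹ • y, continuous_const_smul _⟩))
    (fun f g h => by
      obtain ⟨a, ha⟩ := FunModConst.mk_eq_mk.1 (Quotient.sound h)
      exact FunModConst.mk_eq_mk.2 ⟨a, fun y => ha _⟩)
  one_smul := by
    rintro ⟨f⟩
    exact FunModConst.mk_eq_mk.2 ⟨0, fun y => by simp⟩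
  mul_smul γ γ' := by
    rintro ⟨f⟩
    exact FunModConst.mk_eq_mk.2 ⟨0, fun y => by simp [mul_smul]⟩

theorem FunModConst.smul_mk {G Y : Type*} [Group G] [TopologicalSpace Y] [MulAction G Y]
    [ContinuousConstSMul G Y] (γ : G) (f : C(Y, ℝ)) :
    γ • FunModConst.mk f =
      FunModConst.mk (f.comp ⟨fun y => γ⁻¹ • y, continuous_const_smul _⟩) := rfl

instance funModConstContinuousConstSMul {G Y : Type*} [Group G] [TopologicalSpace Y]
    [MulAction G Y] [ContinuousConstSMul G Y] : ContinuousConstSMul G (FunModConst Y) where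
  continuous_const_smul _ :=
    Continuous.quotient_lift
      (continuous_quotient_mk'.comp (ContinuousMap.continuous_precomp _)) _

theorem smul_distClass {G Y : Type*} [Group G] [MetricSpace Y] [MulAction G Y]
    [IsIsometricSMul G Y] (γ : G) (p : Y) : γ • distClass p = distClass (γ • p) := by
  refine FunModConst.mk_eq_mk.2 ⟨0, fun y => ?_⟩
  show dist (γ • p) y = dist p (γ⁻¹ • y) + 0
  rw [add_zero, ← dist_smul γ p, smul_inv_smul]

theorem smul_mem_horofunctionBoundary {G Y : Type*} [Group G] [MetricSpace Y] [MulAction G Y]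
    [IsIsometricSMul G Y] (γ : G) {η : FunModConst Y} (h : η ∈ horofunctionBoundary Y) :
    γ • η ∈ horofunctionBoundary Y := by
  refine ⟨?_, ?_⟩
  · refine map_mem_closure (continuous_const_smul γ) h.1 ?_
    rintro _ ⟨p, rfl⟩
    exact ⟨γ • p, (smul_distClass γ p).symm⟩
  · rintro ⟨p, hp⟩
    refine h.2 ⟨γ⁻¹ • p, ?_⟩
    rw [← smul_distClass, hp, inv_smul_smul]

/-! ### The ideal domain -/

/-- The function `(z, z') ↦ max {β_c(z), β_{c'}(z') + C}` on `X × X`. -/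
noncomputable def maxBusemann {X : Type*} [MetricSpace X] (c c' : GeodesicRay X) (C : ℝ) :
    C(X × X, ℝ) where
  toFun z := max (busemann c z.1) (busemann c' z.2 + C)
  continuous_toFun :=
    ((continuous_busemann c).comp continuous_fst).max
      (((continuous_busemann c').comp continuous_snd).add continuous_const)

/-- The ideal domain `Ω`: the points of the horofunction boundary of `X × X`, for the maximum
metric (which is the metric of `X × X` in Mathlib), that have a representative
`max {β_ξ(z), β_{ξ'}(z') + C}` with `ξ ≠ ξ'`. -/
def idealDomain (X : Type*) [MetricSpace X] : Set (FunModConst (X × X)) :=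
  {η ∈ horofunctionBoundary (X × X) | ∃ (c c' : GeodesicRay X) (C : ℝ),
    c.endpoint ≠ c'.endpoint ∧ η = FunModConst.mk (maxBusemann c c' C)}

/-- The image of a ray under an isometry. -/
def GeodesicRay.map {X : Type*} [MetricSpace X] (γ : X ≃ᵢ X) (c : GeodesicRay X) :
    GeodesicRay X :=
  ⟨fun t => γ (c t), γ.isometry.comp c.isometry_toFun⟩

theorem busemann_map {X : Type*} [MetricSpace X] (γ : X ≃ᵢ X) (c : GeodesicRay X) (x : X) :
    busemann (c.map γ) x = busemann c (γ⁻¹ • x) := by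
  refine tendsto_nhds_unique (tendsto_busemann (c.map γ) x) ?_
  refine (tendsto_busemann c (γ⁻¹ • x)).congr fun t => ?_
  show dist (γ⁻¹ • x) (c t) - (t : ℝ) = dist x (γ • c t) - (t : ℝ)
  rw [← dist_smul γ (γ⁻¹ • x), smul_inv_smul]

theorem GeodesicRay.endpoint_map_ne {X : Type*} [MetricSpace X] (γ : X ≃ᵢ X)
    {c c' : GeodesicRay X} (h : c.endpoint ≠ c'.endpoint) :
    (c.map γ).endpoint ≠ (c'.map γ).endpoint := by
  intro h'
  obtain ⟨C, hC⟩ := Quotient.exact h'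
  exact h (Quotient.sound ⟨C, fun t => by
    have := hC t
    rwa [show dist ((c.map γ) t) ((c'.map γ) t) = dist (c t) (c' t) from
      γ.isometry.dist_eq _ _] at this⟩)

theorem smul_mem_idealDomain {X : Type*} [MetricSpace X] (γ : X ≃ᵢ X)
    {η : FunModConst (X × X)} (h : η ∈ idealDomain X) : γ • η ∈ idealDomain X := by
  obtain ⟨hη, c, c', C, hne, rfl⟩ := h
  refine ⟨smul_mem_horofunctionBoundary γ hη, c.map γ, c'.map γ, C,
    GeodesicRay.endpoint_map_ne γ hne, ?_⟩
  refine FunModConst.mk_eq_mk.2 ⟨0, fun z => ?_⟩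
  show max (busemann (c.map γ) z.1) (busemann (c'.map γ) z.2 + C) =
    max (busemann c (γ⁻¹ • z).1) (busemann c' (γ⁻¹ • z).2 + C) + 0
  rw [busemann_map, busemann_map, add_zero]
  rfl

/-- The action of the isometry group (hence of its subgroups) on the ideal domain, induced by the
diagonal action on `X × X`. -/
instance idealDomainMulAction {X : Type*} [MetricSpace X] :
    MulAction (X ≃ᵢ X) (idealDomain X) where
  smul γ η := ⟨γ • (η : FunModConst (X × X)), smul_mem_idealDomain γ η.2⟩
  one_smul η := Subtype.ext (one_smul _ (η : FunModConst (X × X)))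
  mul_smul γ γ' η := Subtype.ext (mul_smul γ γ' (η : FunModConst (X × X)))

/-!
Restricted to the diagonal, a representative of a point of `Ω` is the function
`x ↦ max {β_c(x), β_{c'}(x) + C}`. It is quasi-convex along geodesics and, since `c` and `c'` have
distinct endpoints, proper; hence it attains its minimum. Assigning to a point of `Ω` these
minima is `Γ`-equivariant and transfers both properties of the action from `X` to `Ω`:

* Cocompactness follows once the points of `Ω` with a diagonal minimum in a given compact set form
  a compact set. Rays can be based at a fixed point, where they form a compact space, and Busemann
  functions depend continuously on them, because `d(x, c(t)) - t` converges exponentially fast,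
  locally uniformly in `x` and uniformly in `c`. The constant `C` is bounded, because both terms of
  the maximum agree at a minimum.
* Proper discontinuity follows once the diagonal minima are locally bounded on `Ω`. If a
  quasi-convex function is larger on a sphere than at its centre, then all its minima lie inside the
  sphere, and the first condition is stable under uniform approximation.

Curvature enters only through the hyperbolic version of Stewart's theorem, which becomes an
inequality for a triangle in a `CAT(-1)` space.
-/

/-! ### The hyperboloid model of the hyperbolic plane -/

section Hyperboloid

open Real

/-- The Minkowski form `t t' - x x' - y y'` on `ℝ³`, whose unit vectors with `t > 0` are the points
of the hyperboloid model of the hyperbolic plane. -/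
def minkowskiForm (v w : ℝ × ℝ × ℝ) : ℝ := v.1 * w.1 - v.2.1 * w.2.1 - v.2.2 * w.2.2

/-- The point of the hyperboloid model that corresponds to a point of the upper half-plane, under
the isometry that maps `i` to `(1, 0, 0)` and the imaginary half-line into the plane `y = 0`. In
this model the hyperbolic cosine of the distance is bilinear, and hyperbolic trigonometry becomes
linear algebra. -/
noncomputable def toHyperboloid (z : UpperHalfPlane) : ℝ × ℝ × ℝ :=
  ((1 + (z.re ^ 2 + z.im ^ 2)) / (2 * z.im), (z.re ^ 2 + z.im ^ 2 - 1) / (2 * z.im), z.re / z.im)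

theorem minkowskiForm_smul_add_smul_right (u v w : ℝ × ℝ × ℝ) (a b : ℝ) :
    minkowskiForm u (a • v + b • w) = a * minkowskiForm u v + b * minkowskiForm u w := by
  simp only [minkowskiForm, Prod.fst_add, Prod.snd_add, Prod.smul_fst, Prod.smul_snd, smul_eq_mul]
  ring

theorem minkowskiForm_smul_add_smul_self (v w : ℝ × ℝ × ℝ) (a b : ℝ) :
    minkowskiForm (a • v + b • w) (a • v + b • w) =
      a ^ 2 * minkowskiForm v v + b ^ 2 * minkowskiForm w w + 2 * a * b * minkowskiForm v w := by
  simp only [minkowskiForm, Prod.fst_add, Prod.snd_add, Prod.smul_fst, Prod.smul_snd, smul_eq_mul]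
  ring

theorem cosh_dist_eq_minkowskiForm (z w : UpperHalfPlane) :
    cosh (dist z w) = minkowskiForm (toHyperboloid z) (toHyperboloid w) := by
  have hz := z.im_ne_zero
  have hw := w.im_ne_zero
  rw [UpperHalfPlane.cosh_dist', minkowskiForm, toHyperboloid, toHyperboloid]
  field_simp
  ring

theorem minkowskiForm_toHyperboloid_self (z : UpperHalfPlane) :
    minkowskiForm (toHyperboloid z) (toHyperboloid z) = 1 := by
  rw [← cosh_dist_eq_minkowskiForm, dist_self, cosh_zero]

theorem toHyperboloid_fst_pos (z : UpperHalfPlane) : 0 < (toHyperboloid z).1 := by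
  have := z.im_pos
  rw [toHyperboloid]
  positivity

theorem exists_toHyperboloid_eq {v : ℝ × ℝ × ℝ} (hpos : 0 < v.1) (hv : minkowskiForm v v = 1) :
    ∃ z : UpperHalfPlane, toHyperboloid z = v := by
  obtain ⟨t, x, y⟩ := v
  simp only [minkowskiForm] at hpos hv
  have hlt : 0 < t - x := by nlinarith [sq_nonneg y]
  refine ⟨⟨⟨y / (t - x), 1 / (t - x)⟩, by simpa using hlt⟩, ?_⟩
  simp only [toHyperboloid, UpperHalfPlane.re, UpperHalfPlane.im, Prod.mk.injEq]
  refine ⟨?_, ?_, ?_⟩ <;> field_simp <;> linarith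

theorem sinh_sub_sq_add_sinh_sq (s t : ℝ) :
    sinh (t - s) ^ 2 + sinh s ^ 2 + 2 * sinh (t - s) * sinh s * cosh t = sinh t ^ 2 := by
  rw [sinh_sub]
  linear_combination sinh t ^ 2 * cosh_sq s - sinh s ^ 2 * cosh_sq t

theorem exists_cosh_dist_mul_sinh_eq {p q : UpperHalfPlane} (hpq : p ≠ q) {s : ℝ}
    (hs : s ∈ Icc 0 (dist p q)) :
    ∃ m : UpperHalfPlane, ∀ z : UpperHalfPlane, cosh (dist z m) * sinh (dist p q) =
      cosh (dist z p) * sinh (dist p q - s) + cosh (dist z q) * sinh s := by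
  have hpos : 0 < sinh (dist p q) := sinh_pos_iff.2 (dist_pos.2 hpq)
  have hu : 0 ≤ sinh (dist p q - s) := sinh_nonneg_iff.2 (sub_nonneg.2 hs.2)
  have hv : 0 ≤ sinh s := sinh_nonneg_iff.2 hs.1
  have huv := sinh_sub_sq_add_sinh_sq s (dist p q)
  rw [cosh_dist_eq_minkowskiForm] at huv
  -- In the hyperboloid model `m` is the combination `a • p + b • q`.
  set a := sinh (dist p q - s) / sinh (dist p q) with ha
  set b := sinh s / sinh (dist p q) with hb
  have hfst : 0 < a * (toHyperboloid p).1 + b * (toHyperboloid q).1 := by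
    have hp := toHyperboloid_fst_pos p
    have hq := toHyperboloid_fst_pos q
    rcases hs.1.eq_or_lt with rfl | hs'
    · rw [ha, hb, sub_zero, sinh_zero]
      simpa [hpos.ne'] using hp
    · have := sinh_pos_iff.2 hs'
      positivity
  obtain ⟨m, hm⟩ := exists_toHyperboloid_eq (v := a • toHyperboloid p + b • toHyperboloid q) hfst
    (by
      rw [minkowskiForm_smul_add_smul_self, minkowskiForm_toHyperboloid_self,
        minkowskiForm_toHyperboloid_self, ha, hb]
      field_simp
      linarith)
  refine ⟨m, fun z => ?_⟩
  simp only [cosh_dist_eq_minkowskiForm z, hm, minkowskiForm_smul_add_smul_right, ha, hb]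
  field_simp

theorem isGeodesicSegment_of_cosh_dist_mul_sinh_eq {X : Type*} [MetricSpace X] {p q : X}
    (hpq : p ≠ q) {k : ℝ → X}
    (hk : ∀ s ∈ Icc 0 (dist p q), ∀ z, cosh (dist z (k s)) * sinh (dist p q) =
      cosh (dist z p) * sinh (dist p q - s) + cosh (dist z q) * sinh s) :
    IsGeodesicSegment k p q := by
  have hT : 0 < dist p q := dist_pos.2 hpq
  have hS : sinh (dist p q) ≠ 0 := (sinh_pos_iff.2 hT).ne'
  have dist_left : ∀ s ∈ Icc 0 (dist p q), dist p (k s) = s := fun s hs => by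
    refine cosh_injOn dist_nonneg hs.1 (mul_right_cancel₀ hS ?_)
    rw [hk s hs p, dist_self, cosh_zero, sinh_sub]
    ring
  have dist_right : ∀ s ∈ Icc 0 (dist p q), dist q (k s) = dist p q - s := fun s hs => by
    refine cosh_injOn dist_nonneg (sub_nonneg.2 hs.2) (mul_right_cancel₀ hS ?_)
    rw [hk s hs q, dist_self, cosh_zero, dist_comm q p, sinh_sub, cosh_sub]
    linear_combination -sinh s * cosh_sq (dist p q)
  refine ⟨?_, ?_, fun s hs t ht => ?_⟩
  · exact (dist_eq_zero.1 (dist_left 0 ⟨le_rfl, hT.le⟩)).symm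
  · refine (dist_eq_zero.1 ?_).symm
    rw [dist_right _ ⟨hT.le, le_rfl⟩, sub_self]
  · refine cosh_injOn dist_nonneg (abs_nonneg (s - t)) (mul_right_cancel₀ hS ?_)
    rw [hk t ht, dist_comm (k s) p, dist_comm (k s) q, dist_left s hs, dist_right s hs, cosh_abs,
      sinh_sub, cosh_sub, cosh_sub]
    ring

theorem exists_isGeodesicSegment_cosh_dist_mul_sinh_eq (p q : UpperHalfPlane) :
    ∃ k : ℝ → UpperHalfPlane, IsGeodesicSegment k p q ∧ ∀ s ∈ Icc 0 (dist p q), ∀ z,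
      cosh (dist z (k s)) * sinh (dist p q) =
        cosh (dist z p) * sinh (dist p q - s) + cosh (dist z q) * sinh s := by
  rcases eq_or_ne p q with rfl | hpq
  · have hzero : ∀ s ∈ Icc 0 (dist p p), s = 0 := by simp
    refine ⟨fun _ => p, ⟨rfl, rfl, fun s hs t ht => ?_⟩, fun s hs z => ?_⟩
    · simp [hzero s hs, hzero t ht]
    · simp [hzero s hs]
  have hpoint : ∀ s : ℝ, ∃ m : UpperHalfPlane, s ∈ Icc 0 (dist p q) → ∀ z,
      cosh (dist z m) * sinh (dist p q) =
        cosh (dist z p) * sinh (dist p q - s) + cosh (dist z q) * sinh s := fun s => by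
    by_cases hs : s ∈ Icc 0 (dist p q)
    · exact (exists_cosh_dist_mul_sinh_eq hpq hs).imp fun m hm _ => hm
    · exact ⟨p, fun h => absurd h hs⟩
  choose k hk using hpoint
  exact ⟨k, isGeodesicSegment_of_cosh_dist_mul_sinh_eq hpq hk, hk⟩

theorem abs_cosh_mul_cosh_sub_cosh_le {a b c : ℝ} (ha : 0 ≤ a) (hb : 0 ≤ b) (hc : 0 ≤ c)
    (hcab : c ≤ a + b) (habc : a ≤ b + c) (hbac : b ≤ a + c) :
    |cosh a * cosh b - cosh c| ≤ sinh a * sinh b := by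
  have hadd : cosh c ≤ cosh (a + b) := cosh_le_cosh.2 (by
    rwa [abs_of_nonneg hc, abs_of_nonneg (add_nonneg ha hb)])
  have hsub : cosh (a - b) ≤ cosh c := cosh_le_cosh.2 (by
    rw [abs_of_nonneg hc, abs_le]
    constructor <;> linarith)
  rw [cosh_add] at hadd
  rw [cosh_sub] at hsub
  rw [abs_le]
  constructor <;> linarith

theorem exists_dist_eq_dist_eq_dist_eq {a b c : ℝ} (ha : 0 < a) (hb : 0 ≤ b) (hc : 0 ≤ c)
    (hcab : c ≤ a + b) (habc : a ≤ b + c) (hbac : b ≤ a + c) :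
    ∃ p q r : UpperHalfPlane, dist p q = a ∧ dist p r = b ∧ dist q r = c := by
  have hS : 0 < sinh a := sinh_pos_iff.2 ha
  set x := (cosh a * cosh b - cosh c) / sinh a with hx
  have hxb : x ^ 2 ≤ sinh b ^ 2 := by
    rw [hx, div_pow, div_le_iff₀ (pow_pos hS 2), ← mul_pow, mul_comm (sinh b)]
    exact sq_le_sq.2 ((abs_cosh_mul_cosh_sub_cosh_le ha.le hb hc hcab habc hbac).trans
      (le_abs_self _))
  obtain ⟨p, hp⟩ := exists_toHyperboloid_eq (v := (1, 0, 0)) one_pos (by simp [minkowskiForm])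
  obtain ⟨q, hq⟩ := exists_toHyperboloid_eq (v := (cosh a, sinh a, 0)) (cosh_pos a) (by
    simp only [minkowskiForm]
    linear_combination cosh_sq a)
  obtain ⟨r, hr⟩ := exists_toHyperboloid_eq (v := (cosh b, x, √(sinh b ^ 2 - x ^ 2)))
    (cosh_pos b) (by
      simp only [minkowskiForm]
      linear_combination cosh_sq b - mul_self_sqrt (sub_nonneg.2 hxb))
  refine ⟨p, q, r, cosh_injOn dist_nonneg ha.le ?_, cosh_injOn dist_nonneg hb ?_,
    cosh_injOn dist_nonneg hc ?_⟩
  · simp [cosh_dist_eq_minkowskiForm, hp, hq, minkowskiForm]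
  · simp [cosh_dist_eq_minkowskiForm, hp, hr, minkowskiForm]
  · simp only [cosh_dist_eq_minkowskiForm, hq, hr, minkowskiForm, hx]
    field_simp
    ring

theorem IsCATNegOne.cosh_dist_mul_sinh_le {X : Type*} [MetricSpace X] (hX : IsCATNegOne X)
    {p q : X} {σ : ℝ → X} (hσ : IsGeodesicSegment σ p q) {s : ℝ} (hs : s ∈ Icc 0 (dist p q))
    (z : X) :
    cosh (dist z (σ s)) * sinh (dist p q) ≤
      cosh (dist z p) * sinh (dist p q - s) + cosh (dist z q) * sinh s := by
  rcases eq_or_ne p q with rfl | hpq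
  · rw [dist_self, Icc_self, mem_singleton_iff] at hs
    simp [hs]
  obtain ⟨p₀, q₀, z₀, hpq₀, hpz₀, hqz₀⟩ := exists_dist_eq_dist_eq_dist_eq (dist_pos.2 hpq)
    (dist_nonneg (x := p) (y := z)) (dist_nonneg (x := q) (y := z))
    (dist_triangle_left q z p) (dist_triangle_right p q z) (dist_triangle p q z)
  obtain ⟨k, hk, hk_eq⟩ := exists_isGeodesicSegment_cosh_dist_mul_sinh_eq p₀ q₀
  obtain ⟨k', hk', -⟩ := exists_isGeodesicSegment_cosh_dist_mul_sinh_eq p₀ z₀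
  obtain ⟨τ, hτ⟩ := hX.exists_segment p z
  have hle : dist z (σ s) ≤ dist z₀ (k s) := by
    have h := hX.comparison p q z σ τ hσ hτ p₀ q₀ z₀ k k' hpq₀ hpz₀ hqz₀ hk hk' s hs (dist p z)
      ⟨dist_nonneg, le_rfl⟩
    rwa [hτ.map_dist, ← hpz₀, hk'.map_dist, dist_comm, dist_comm _ z₀] at h
  have hstewart := hk_eq s (by rwa [hpq₀]) z₀
  rw [hpq₀, dist_comm z₀ p₀, dist_comm z₀ q₀, hpz₀, hqz₀, dist_comm p z, dist_comm q z]
    at hstewart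
  rw [← hstewart]
  refine mul_le_mul_of_nonneg_right (cosh_le_cosh.2 ?_) (sinh_nonneg_iff.2 dist_nonneg)
  rwa [abs_of_nonneg dist_nonneg, abs_of_nonneg dist_nonneg]

end Hyperboloid

/-! ### Limits of hyperbolic functions -/

section RealLimits

open Real

variable {ι : Type*} {l : Filter ι}

theorem tendsto_two_mul_cosh_mul_exp_neg {T u : ι → ℝ} {B : ℝ} (hT : Tendsto T l atTop)
    (hu : Tendsto (fun i => u i - T i) l (𝓝 B)) :
    Tendsto (fun i => 2 * cosh (u i) * exp (-T i)) l (𝓝 (exp B)) := by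
  have hmain : Tendsto (fun i => exp (u i - T i)) l (𝓝 (exp B)) :=
    (continuous_exp.tendsto B).comp hu
  have herror : Tendsto (fun i => exp (-(u i - T i) + -(2 * T i))) l (𝓝 0) :=
    tendsto_exp_atBot.comp
      (hu.neg.add_atBot (tendsto_neg_atTop_atBot.comp (hT.const_mul_atTop two_pos)))
  refine (add_zero (exp B) ▸ hmain.add herror).congr fun i => ?_
  rw [cosh_eq, mul_div_cancel₀ _ two_ne_zero, add_mul, ← exp_add, ← exp_add]
  congr 2
  ring

theorem tendsto_two_mul_sinh_sub_mul_exp_neg {T : ι → ℝ} (hT : Tendsto T l atTop) (s : ℝ) :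
    Tendsto (fun i => 2 * sinh (T i - s) * exp (-T i)) l (𝓝 (exp (-s))) := by
  have herror : Tendsto (fun i => exp (s + -(2 * T i))) l (𝓝 0) :=
    tendsto_exp_atBot.comp (tendsto_const_nhds.add_atBot
      (tendsto_neg_atTop_atBot.comp (hT.const_mul_atTop two_pos)))
  refine (sub_zero (exp (-s)) ▸ tendsto_const_nhds.sub herror).congr fun i => ?_
  rw [sinh_eq, mul_div_cancel₀ _ two_ne_zero, sub_mul, ← exp_add, ← exp_add]
  congr 2 <;> ring

theorem tendsto_two_mul_sinh_mul_exp_neg {T : ι → ℝ} (hT : Tendsto T l atTop) :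
    Tendsto (fun i => 2 * sinh (T i) * exp (-T i)) l (𝓝 1) := by
  simpa using tendsto_two_mul_sinh_sub_mul_exp_neg hT 0

theorem tendsto_two_mul_exp_neg_two_mul (K : ℝ) :
    Tendsto (fun s : NNReal => 2 * exp (-(2 * s)) * K) atTop (𝓝 0) := by
  have hexp : Tendsto (fun s : NNReal => exp (-(2 * s))) atTop (𝓝 0) :=
    tendsto_exp_atBot.comp (tendsto_neg_atTop_atBot.comp
      ((NNReal.tendsto_coe_atTop.2 tendsto_id).const_mul_atTop two_pos))
  simpa using (hexp.const_mul 2).mul_const K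

theorem exp_sub_le_of_cosh_le {a b s B : ℝ} (h : cosh b ≤ cosh a * exp (-s) + exp B * sinh s) :
    exp (b - s) ≤ exp B + 2 * exp (-(2 * s)) * cosh a := by
  have hb : exp b ≤ 2 * cosh b := by
    rw [cosh_eq]
    linarith [exp_pos (-b)]
  have hinv : exp s * exp (-s) = 1 := by rw [← exp_add, add_neg_cancel, exp_zero]
  have hsq : exp (-(2 * s)) = exp (-s) * exp (-s) := by rw [← exp_add]; ring_nf
  calc exp (b - s) = exp b * exp (-s) := by rw [sub_eq_add_neg, exp_add]
    _ ≤ 2 * (cosh a * exp (-s) + exp B * sinh s) * exp (-s) := by gcongr; linarith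
    _ = exp B * (1 - exp (-(2 * s))) + 2 * exp (-(2 * s)) * cosh a := by
      rw [sinh_eq, hsq]
      linear_combination exp B * hinv
    _ ≤ exp B + 2 * exp (-(2 * s)) * cosh a := by
      linarith [mul_pos (exp_pos B) (exp_pos (-(2 * s)))]

theorem sinh_add_sinh_le_sinh_add {a b : ℝ} (ha : 0 ≤ a) (hb : 0 ≤ b) :
    sinh a + sinh b ≤ sinh (a + b) := by
  rw [sinh_add]
  exact add_le_add (le_mul_of_one_le_right (sinh_nonneg_iff.2 ha) (one_le_cosh b))
    (le_mul_of_one_le_left (sinh_nonneg_iff.2 hb) (one_le_cosh a))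

theorem cosh_le_exp_of_abs_le {a b : ℝ} (h : |a| ≤ b) : cosh a ≤ exp b := by
  have hneg : exp (-|a|) ≤ exp |a| := exp_le_exp.2 (neg_le_self (abs_nonneg a))
  calc cosh a = (exp |a| + exp (-|a|)) / 2 := by rw [← cosh_abs, cosh_eq]
    _ ≤ exp |a| := by linarith
    _ ≤ exp b := exp_le_exp.2 h

end RealLimits

/-! ### Properties of Busemann functions -/

section Rays

variable {X : Type*} [MetricSpace X]

theorem IsGeodesicSegment.dist_left {σ : ℝ → X} {p q : X} (hσ : IsGeodesicSegment σ p q) {s : ℝ}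
    (hs : s ∈ Icc 0 (dist p q)) : dist p (σ s) = s := by
  have h := hσ.dist_eq 0 ⟨le_rfl, dist_nonneg⟩ s hs
  rwa [hσ.map_zero, zero_sub, abs_neg, abs_of_nonneg hs.1] at h

theorem IsGeodesicSegment.dist_right {σ : ℝ → X} {p q : X} (hσ : IsGeodesicSegment σ p q) {s : ℝ}
    (hs : s ∈ Icc 0 (dist p q)) : dist (σ s) q = dist p q - s := by
  have h := hσ.dist_eq s hs (dist p q) ⟨dist_nonneg, le_rfl⟩
  rwa [hσ.map_dist, abs_sub_comm, abs_of_nonneg (sub_nonneg.2 hs.2)] at h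

theorem GeodesicRay.dist_eq (c : GeodesicRay X) (s t : NNReal) :
    dist (c s) (c t) = |(s : ℝ) - t| := by
  rw [c.isometry_toFun.dist_eq, NNReal.dist_eq]

theorem GeodesicRay.dist_zero (c : GeodesicRay X) (t : NNReal) : dist (c 0) (c t) = t := by
  rw [c.dist_eq, NNReal.coe_zero, zero_sub, abs_neg, NNReal.abs_eq]

theorem GeodesicRay.isGeodesicSegment (c : GeodesicRay X) (T : NNReal) :
    IsGeodesicSegment (fun s => c s.toNNReal) (c 0) (c T) where
  map_zero := by rw [Real.toNNReal_zero]
  map_dist := by rw [c.dist_zero, Real.toNNReal_coe]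
  dist_eq s hs t ht := by
    rw [c.dist_eq, Real.coe_toNNReal _ hs.1, Real.coe_toNNReal _ ht.1]

theorem GeodesicRay.antitone_dist_sub (c : GeodesicRay X) (x : X) :
    Antitone fun t : NNReal => dist x (c t) - t := by
  intro s t hst
  have h := dist_triangle x (c s) (c t)
  rw [c.dist_eq, abs_sub_comm, abs_of_nonneg (sub_nonneg.2 (NNReal.coe_le_coe.2 hst))] at h
  change dist x (c t) - t ≤ dist x (c s) - s
  linarith

theorem busemann_le_dist_sub (c : GeodesicRay X) (x : X) (t : NNReal) :
    busemann c x ≤ dist x (c t) - t :=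
  (c.antitone_dist_sub x).le_of_tendsto (tendsto_busemann c x) t

theorem busemann_le_add_dist (c : GeodesicRay X) (x y : X) :
    busemann c x ≤ busemann c y + dist x y :=
  le_of_tendsto_of_tendsto' (tendsto_busemann c x) ((tendsto_busemann c y).add_const _)
    (fun t => by linarith [dist_triangle x y (c t)])

theorem abs_busemann_sub_le (c : GeodesicRay X) (x y : X) :
    |busemann c x - busemann c y| ≤ dist x y := by
  have hxy := busemann_le_add_dist c x y
  have hyx := busemann_le_add_dist c y x
  rw [dist_comm y x] at hyx
  exact abs_le.2 ⟨by linarith, by linarith⟩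

theorem busemann_apply (c : GeodesicRay X) (t : NNReal) : busemann c (c t) = -t := by
  refine le_antisymm (by simpa using busemann_le_dist_sub c (c t) t) ?_
  refine ge_of_tendsto' (tendsto_busemann c (c t)) fun s => ?_
  rw [c.dist_eq]
  linarith [neg_abs_le ((t : ℝ) - s)]

theorem busemann_apply_zero (c : GeodesicRay X) : busemann c (c 0) = 0 := by
  rw [busemann_apply, NNReal.coe_zero, neg_zero]

theorem tendsto_dist_sub_dist (c : GeodesicRay X) (x y : X) :
    Tendsto (fun t : NNReal => dist x (c t) - dist y (c t)) atTop
      (𝓝 (busemann c x - busemann c y)) :=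
  ((tendsto_busemann c x).sub (tendsto_busemann c y)).congr fun t => by ring

theorem GeodesicRay.tendsto_dist_atTop (c : GeodesicRay X) (x : X) :
    Tendsto (fun t : NNReal => dist x (c t)) atTop atTop :=
  ((tendsto_busemann c x).add_atTop (NNReal.tendsto_coe_atTop.2 tendsto_id)).congr
    fun _ => sub_add_cancel _ _

theorem endpoint_ne_of_le_max {c c' : GeodesicRay X} {C m : ℝ}
    (h : ∀ x, m ≤ max (busemann c x) (busemann c' x + C)) : c.endpoint ≠ c'.endpoint := by
  intro heq
  obtain ⟨K, hK⟩ := Quotient.exact heq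
  obtain ⟨t, ht⟩ : ∃ t : NNReal, max (-m) (K + C - m) < t :=
    ⟨(max (-m) (K + C - m) + 1).toNNReal, (lt_add_one _).trans_le (Real.le_coe_toNNReal _)⟩
  rw [max_lt_iff] at ht
  have hc' := busemann_le_add_dist c' (c t) (c' t)
  rw [busemann_apply] at hc'
  rcases le_max_iff.1 (h (c t)) with hle | hle
  · rw [busemann_apply] at hle
    linarith
  · linarith [hK t]

end Rays

/-! ### Limits of segments -/

section SegmentsTendsto

variable {X ι : Type*} [MetricSpace X] {l : Filter ι} {σ : ι → ℝ → X} {x : ι → X}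
  {r : GeodesicRay X}

/-- The segments `σ i` from the origin of the ray `r` to the points `x i`, which go to infinity,
converge pointwise to `r` along the filter `l`. -/
structure SegmentsTendsto (l : Filter ι) (σ : ι → ℝ → X) (x : ι → X) (r : GeodesicRay X) :
    Prop where
  isGeodesicSegment : ∀ i, IsGeodesicSegment (σ i) (r 0) (x i)
  tendsto_dist : Tendsto (fun i => dist (r 0) (x i)) l atTop
  tendsto_apply : ∀ t : NNReal, Tendsto (fun i => σ i t) l (𝓝 (r t))

theorem eventually_coe_mem_Icc {T : ι → ℝ} (hT : Tendsto T l atTop) (t : NNReal) :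
    ∀ᶠ i in l, (t : ℝ) ∈ Icc 0 (T i) :=
  (hT.eventually_ge_atTop (t : ℝ)).mono fun _ hi => ⟨t.2, hi⟩

theorem GeodesicRay.segmentsTendsto (r : GeodesicRay X) :
    SegmentsTendsto atTop (fun (_ : NNReal) s => r s.toNNReal) (fun T => r T) r where
  isGeodesicSegment := r.isGeodesicSegment
  tendsto_dist := r.tendsto_dist_atTop (r 0)
  tendsto_apply t := by simp only [Real.toNNReal_coe, tendsto_const_nhds]

theorem exists_segmentsTendsto [ProperSpace X] [l.NeBot] {o : X}
    (hσ : ∀ i, IsGeodesicSegment (σ i) o (x i))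
    (hx : Tendsto (fun i => dist o (x i)) l atTop) :
    ∃ (U : Ultrafilter ι) (r : GeodesicRay X), ↑U ≤ l ∧ r 0 = o ∧ SegmentsTendsto U σ x r := by
  set U : Ultrafilter ι := Ultrafilter.of l
  have hU : ↑U ≤ l := Ultrafilter.of_le l
  have hmem := eventually_coe_mem_Icc (hx.mono_left hU)
  have hlim : ∀ t : NNReal, ∃ y, Tendsto (fun i => σ i t) U (𝓝 y) := fun t => by
    have hball : ∀ᶠ i in U, σ i t ∈ Metric.closedBall o t := (hmem t).mono fun i hi => by
      rw [Metric.mem_closedBall', (hσ i).dist_left hi]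
    obtain ⟨y, -, hy⟩ := (isCompact_closedBall o (t : ℝ)).ultrafilter_le_nhds
      (U.map fun i => σ i t) (le_principal_iff.2 hball)
    exact ⟨y, hy⟩
  choose f hf using hlim
  have hiso : Isometry f := Isometry.of_dist_eq fun s t => by
    refine tendsto_nhds_unique ((hf s).dist (hf t)) (tendsto_const_nhds.congr' ?_)
    filter_upwards [hmem s, hmem t] with i hs ht
    rw [(hσ i).dist_eq s hs t ht, NNReal.dist_eq]
  have hzero : f 0 = o := tendsto_nhds_unique (hf 0) (tendsto_const_nhds.congr fun i => by
    rw [NNReal.coe_zero, (hσ i).map_zero])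
  refine ⟨U, ⟨f, hiso⟩, hU, hzero, ?_, ?_, hf⟩
  · simpa only [hzero] using hσ
  · simpa only [hzero] using hx.mono_left hU

theorem SegmentsTendsto.le_busemann [l.NeBot] (h : SegmentsTendsto l σ x r) {z : X} {B : ℝ}
    (hB : Tendsto (fun i => dist z (x i) - dist (r 0) (x i)) l (𝓝 B)) : B ≤ busemann r z := by
  refine ge_of_tendsto' (tendsto_busemann r z) fun s => ?_
  refine le_of_tendsto_of_tendsto hB
    ((tendsto_const_nhds.dist (h.tendsto_apply s)).sub tendsto_const_nhds) ?_
  filter_upwards [eventually_coe_mem_Icc h.tendsto_dist s] with i hi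
  linarith [dist_triangle z (σ i s) (x i), (h.isGeodesicSegment i).dist_right hi]

end SegmentsTendsto

/-! ### Rays in `CAT(-1)` spaces -/

section IdealTriangles

open Real

variable {X ι : Type*} [MetricSpace X] {l : Filter ι} [l.NeBot] {σ : ι → ℝ → X} {x : ι → X}
  {r : GeodesicRay X}

theorem IsCATNegOne.cosh_dist_le_of_segmentsTendsto (hX : IsCATNegOne X)
    (h : SegmentsTendsto l σ x r) {z : X} {B : ℝ}
    (hB : Tendsto (fun i => dist z (x i) - dist (r 0) (x i)) l (𝓝 B)) (s : NNReal) :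
    cosh (dist z (r s)) ≤ cosh (dist z (r 0)) * exp (-s) + exp B * sinh s := by
  have hlhs := ((continuous_cosh.tendsto (dist z (r s))).comp
    ((tendsto_const_nhds (x := z)).dist (h.tendsto_apply s))).mul
      (tendsto_two_mul_sinh_mul_exp_neg h.tendsto_dist)
  have hrhs := ((tendsto_two_mul_sinh_sub_mul_exp_neg h.tendsto_dist s).const_mul
    (cosh (dist z (r 0)))).add
      ((tendsto_two_mul_cosh_mul_exp_neg h.tendsto_dist hB).mul_const (sinh s))
  rw [mul_one] at hlhs
  refine le_of_tendsto_of_tendsto hlhs hrhs ?_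
  filter_upwards [eventually_coe_mem_Icc h.tendsto_dist s] with i hi
  have hle := mul_le_mul_of_nonneg_right
    (hX.cosh_dist_mul_sinh_le (h.isGeodesicSegment i) hi z)
    (mul_nonneg two_pos.le (exp_pos (-dist (r 0) (x i))).le)
  simp only [Function.comp_apply]
  linarith

theorem IsCATNegOne.busemann_eq_of_segmentsTendsto (hX : IsCATNegOne X)
    (h : SegmentsTendsto l σ x r) {z : X} {B : ℝ}
    (hB : Tendsto (fun i => dist z (x i) - dist (r 0) (x i)) l (𝓝 B)) : busemann r z = B := by
  refine le_antisymm (exp_le_exp.1 ?_) (h.le_busemann hB)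
  have hlim := (tendsto_two_mul_exp_neg_two_mul (cosh (dist z (r 0)))).const_add (exp B)
  refine add_zero (exp B) ▸ ge_of_tendsto' hlim fun s => ?_
  exact (exp_le_exp.2 (busemann_le_dist_sub r z s)).trans
    (exp_sub_le_of_cosh_le (hX.cosh_dist_le_of_segmentsTendsto h hB s))

theorem IsCATNegOne.exp_dist_sub_le (hX : IsCATNegOne X) (c : GeodesicRay X) (z : X)
    (s : NNReal) :
    exp (dist z (c s) - s) ≤ exp (busemann c z) + 2 * exp (-(2 * s)) * cosh (dist z (c 0)) := by
  refine exp_sub_le_of_cosh_le (hX.cosh_dist_le_of_segmentsTendsto c.segmentsTendsto ?_ s)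
  simpa only [busemann_apply_zero, sub_zero] using tendsto_dist_sub_dist c z (c 0)

theorem IsCATNegOne.exists_busemann_eq_sub [ProperSpace X] (hX : IsCATNegOne X)
    (c : GeodesicRay X) (o : X) :
    ∃ r : GeodesicRay X, r 0 = o ∧ ∀ z, busemann r z = busemann c z - busemann c o := by
  choose σ hσ using fun t : NNReal => hX.exists_segment o (c t)
  obtain ⟨U, r, hU, hr, h⟩ := exists_segmentsTendsto hσ (c.tendsto_dist_atTop o)
  refine ⟨r, hr, fun z => hX.busemann_eq_of_segmentsTendsto h ?_⟩
  rw [hr]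
  exact (tendsto_dist_sub_dist c z o).mono_left hU

theorem IsCATNegOne.exp_busemann_mul_sinh_le (hX : IsCATNegOne X) (c : GeodesicRay X) {p q : X}
    {σ : ℝ → X} (hσ : IsGeodesicSegment σ p q) {s : ℝ} (hs : s ∈ Icc 0 (dist p q)) :
    exp (busemann c (σ s)) * sinh (dist p q) ≤
      exp (busemann c p) * sinh (dist p q - s) + exp (busemann c q) * sinh s := by
  have hlim : ∀ y, Tendsto (fun t : NNReal => 2 * cosh (dist y (c t)) * exp (-t)) atTop
      (𝓝 (exp (busemann c y))) := fun y =>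
    tendsto_two_mul_cosh_mul_exp_neg (NNReal.tendsto_coe_atTop.2 tendsto_id) (tendsto_busemann c y)
  refine le_of_tendsto_of_tendsto' ((hlim (σ s)).mul_const _)
    (((hlim p).mul_const _).add ((hlim q).mul_const _)) fun t => ?_
  have hle := mul_le_mul_of_nonneg_right (hX.cosh_dist_mul_sinh_le hσ hs (c t))
    (mul_nonneg two_pos.le (exp_pos (-(t : ℝ))).le)
  simp only [dist_comm (c t)] at hle
  linarith

theorem IsCATNegOne.busemann_le_sub_of_segmentsTendsto (hX : IsCATNegOne X)
    (h : SegmentsTendsto l σ x r) {c : GeodesicRay X} {M : ℝ}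
    (hM : ∀ᶠ i in l, busemann c (x i) ≤ M) (t : NNReal) :
    busemann c (r t) ≤ busemann c (r 0) - t := by
  rw [← exp_le_exp, sub_eq_add_neg, exp_add]
  have hlhs := (((continuous_exp.comp (continuous_busemann c)).tendsto _).comp
    (h.tendsto_apply t)).mul (tendsto_two_mul_sinh_mul_exp_neg h.tendsto_dist)
  have hexp : Tendsto (fun i => exp (-dist (r 0) (x i))) l (𝓝 0) :=
    tendsto_exp_atBot.comp (tendsto_neg_atTop_atBot.comp h.tendsto_dist)
  have hrhs := ((tendsto_two_mul_sinh_sub_mul_exp_neg h.tendsto_dist t).const_mul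
    (exp (busemann c (r 0)))).add (hexp.const_mul (2 * exp M * sinh t))
  rw [mul_one] at hlhs
  rw [mul_zero, add_zero] at hrhs
  refine le_of_tendsto_of_tendsto hlhs hrhs ?_
  filter_upwards [eventually_coe_mem_Icc h.tendsto_dist t, hM] with i hi hMi
  have hconvex := hX.exp_busemann_mul_sinh_le c (h.isGeodesicSegment i) hi
  have hend : exp (busemann c (x i)) * sinh t ≤ exp M * sinh t :=
    mul_le_mul_of_nonneg_right (exp_le_exp.2 hMi) (sinh_nonneg_iff.2 t.coe_nonneg)
  have hle := mul_le_mul_of_nonneg_right (hconvex.trans (add_le_add_right hend _))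
    (mul_nonneg two_pos.le (exp_pos (-dist (r 0) (x i))).le)
  simp only [Function.comp_apply]
  linarith

theorem IsCATNegOne.endpoint_eq_of_busemann_le (hX : IsCATNegOne X) {c c' : GeodesicRay X} {K : ℝ}
    (h : ∀ t : NNReal, busemann c (c' t) ≤ K - t) : c.endpoint = c'.endpoint := by
  set L := dist (c' 0) (c 0)
  refine Quotient.sound ⟨log (exp K + 2 * exp L), fun t => ?_⟩
  have hdist : |dist (c' t) (c 0)| ≤ t + L := by
    rw [abs_of_nonneg dist_nonneg]
    have htri := dist_triangle (c' t) (c' 0) (c 0)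
    rwa [dist_comm (c' t) (c' 0), c'.dist_zero] at htri
  rw [le_log_iff_exp_le (by positivity), dist_comm]
  calc exp (dist (c' t) (c t)) = exp (dist (c' t) (c t) - t) * exp t := by
        rw [← exp_add, sub_add_cancel]
    _ ≤ (exp (busemann c (c' t)) + 2 * exp (-(2 * t)) * cosh (dist (c' t) (c 0))) * exp t := by
        gcongr
        exact hX.exp_dist_sub_le c (c' t) t
    _ ≤ (exp (K - t) + 2 * exp (-(2 * t)) * exp (t + L)) * exp t := by
        gcongr
        exacts [h t, cosh_le_exp_of_abs_le hdist]
    _ = exp K + 2 * exp L := by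
        rw [add_mul, ← exp_add, mul_assoc, mul_assoc, ← exp_add, ← exp_add]
        ring_nf

end IdealTriangles

section Quasiconvexity

variable {X : Type*} [MetricSpace X]

/-- A function on a metric space is geodesically quasi-convex if on every geodesic segment it is at
most the maximum of its values at the ends. -/
def GeodesicallyQuasiconvex (h : X → ℝ) : Prop :=
  ∀ ⦃σ : ℝ → X⦄ ⦃p q : X⦄, IsGeodesicSegment σ p q → ∀ s ∈ Icc 0 (dist p q),
    h (σ s) ≤ max (h p) (h q)

theorem GeodesicallyQuasiconvex.add_const {h : X → ℝ} (hh : GeodesicallyQuasiconvex h) (a : ℝ) :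
    GeodesicallyQuasiconvex fun x => h x + a := fun σ p q hσ s hs => by
  rw [max_add_add_right]
  exact add_le_add_left (hh hσ s hs) a

theorem GeodesicallyQuasiconvex.max {g h : X → ℝ} (hg : GeodesicallyQuasiconvex g)
    (hh : GeodesicallyQuasiconvex h) : GeodesicallyQuasiconvex fun x => max (g x) (h x) :=
  fun σ p q hσ s hs => by
    rw [max_max_max_comm]
    exact max_le_max (hg hσ s hs) (hh hσ s hs)

theorem GeodesicallyQuasiconvex.lt_of_forall_sphere_lt
    (hgeodesic : ∀ p q : X, ∃ σ : ℝ → X, IsGeodesicSegment σ p q) {h : X → ℝ}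
    (hh : GeodesicallyQuasiconvex h) {x₀ x : X} {R : ℝ} (hR : 0 ≤ R)
    (hlt : ∀ m ∈ Metric.sphere x₀ R, h x₀ < h m) (hx : R ≤ dist x₀ x) : h x₀ < h x := by
  obtain ⟨σ, hσ⟩ := hgeodesic x₀ x
  have hm : σ R ∈ Metric.sphere x₀ R := by
    rw [Metric.mem_sphere', hσ.dist_left ⟨hR, hx⟩]
  exact (lt_max_iff.1 ((hlt _ hm).trans_le (hh hσ R ⟨hR, hx⟩))).resolve_left (lt_irrefl _)

theorem IsCATNegOne.geodesicallyQuasiconvex_busemann (hX : IsCATNegOne X) (c : GeodesicRay X) :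
    GeodesicallyQuasiconvex (busemann c) := by
  intro σ p q hσ s hs
  rcases eq_or_ne p q with rfl | hpq
  · rw [dist_self, Icc_self, mem_singleton_iff] at hs
    rw [hs, hσ.map_zero, max_self]
  set M := max (busemann c p) (busemann c q)
  have hu : 0 ≤ Real.sinh (dist p q - s) := Real.sinh_nonneg_iff.2 (sub_nonneg.2 hs.2)
  have hv : 0 ≤ Real.sinh s := Real.sinh_nonneg_iff.2 hs.1
  have hle : Real.exp (busemann c (σ s)) * Real.sinh (dist p q) ≤
      Real.exp M * Real.sinh (dist p q) :=
    calc Real.exp (busemann c (σ s)) * Real.sinh (dist p q)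
        ≤ Real.exp (busemann c p) * Real.sinh (dist p q - s) +
          Real.exp (busemann c q) * Real.sinh s := hX.exp_busemann_mul_sinh_le c hσ hs
      _ ≤ Real.exp M * Real.sinh (dist p q - s) + Real.exp M * Real.sinh s := by
          gcongr
          exacts [le_max_left _ _, le_max_right _ _]
      _ = Real.exp M * (Real.sinh (dist p q - s) + Real.sinh s) := by ring
      _ ≤ Real.exp M * Real.sinh (dist p q) := by
          gcongr
          simpa using sinh_add_sinh_le_sinh_add (sub_nonneg.2 hs.2) hs.1
  exact Real.exp_le_exp.1 (le_of_mul_le_mul_right hle (Real.sinh_pos_iff.2 (dist_pos.2 hpq)))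

theorem IsCATNegOne.tendsto_max_busemann_atTop [ProperSpace X] (hX : IsCATNegOne X)
    {c c' : GeodesicRay X} (hne : c.endpoint ≠ c'.endpoint) (C : ℝ) :
    Tendsto (fun x => max (busemann c x) (busemann c' x + C)) (Bornology.cobounded X) atTop := by
  rw [tendsto_atTop]
  by_contra! ⟨M, hM⟩
  -- Otherwise points going to infinity below the level `M` subconverge to a common endpoint.
  set S := {x | max (busemann c x) (busemann c' x + C) < M}
  have hS : (Bornology.cobounded X ⊓ 𝓟 S).NeBot := frequently_iff_neBot.1 hM
  choose σ hσ using hX.exists_segment (c 0)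
  obtain ⟨U, r, hU, -, hr⟩ := exists_segmentsTendsto hσ
    ((Metric.tendsto_dist_left_cobounded_atTop (c 0)).mono_left (inf_le_left (b := 𝓟 S)))
  have hlevel : ∀ᶠ x in U, busemann c x ≤ M ∧ busemann c' x ≤ M - C := by
    filter_upwards [hU (mem_inf_of_right (mem_principal_self _))] with x hx
    obtain ⟨hc, hc'⟩ := max_le_iff.1 (mem_ofPred.1 hx).le
    exact ⟨hc, by linarith⟩
  have heq : ∀ (e : GeodesicRay X) (N : ℝ), (∀ᶠ x in U, busemann e x ≤ N) →
      e.endpoint = r.endpoint := fun e N he =>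
    hX.endpoint_eq_of_busemann_le fun t => hX.busemann_le_sub_of_segmentsTendsto hr he t
  exact hne ((heq c M (hlevel.mono fun _ h => h.1)).trans
    (heq c' (M - C) (hlevel.mono fun _ h => h.2)).symm)

end Quasiconvexity

/-! ### Busemann points of the horofunction boundary -/

section HorofunctionBoundary

variable {X Y : Type*} [MetricSpace X] [MetricSpace Y]

theorem FunModConst.continuous_mk (T : Type*) [TopologicalSpace T] :
    Continuous (FunModConst.mk (Y := T)) :=
  continuous_quotient_mk'

theorem FunModConst.isOpenMap_mk (T : Type*) [TopologicalSpace T] :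
    IsOpenMap (FunModConst.mk (Y := T)) :=
  QuotientAddGroup.isOpenMap_coe

theorem bddBelow_of_mk_mem_range_distClass {f : C(Y, ℝ)}
    (h : FunModConst.mk f ∈ range (distClass (Y := Y))) : BddBelow (range f) := by
  obtain ⟨p, hp⟩ := h
  obtain ⟨a, ha⟩ := FunModConst.mk_eq_mk.1 hp
  refine ⟨a, ?_⟩
  rintro _ ⟨y, rfl⟩
  rw [ha y]
  exact le_add_of_nonneg_left dist_nonneg

theorem not_bddBelow_range_busemann (c : GeodesicRay Y) : ¬BddBelow (range (busemann c)) := by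
  rintro ⟨m, hm⟩
  have h := hm (mem_range_self (c (1 - m).toNNReal))
  rw [busemann_apply] at h
  linarith [Real.le_coe_toNNReal (1 - m)]

theorem mk_busemann_mem_horofunctionBoundary (c : GeodesicRay Y) :
    FunModConst.mk ⟨busemann c, continuous_busemann c⟩ ∈ horofunctionBoundary Y := by
  refine ⟨?_, fun h => not_bddBelow_range_busemann c (bddBelow_of_mk_mem_range_distClass h)⟩
  let F : NNReal → C(Y, ℝ) := fun t => ⟨fun y => dist y (c t) - t, by fun_prop⟩
  have hF : Tendsto F atTop (𝓝 ⟨busemann c, continuous_busemann c⟩) :=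
    ContinuousMap.tendsto_of_antitone_of_pointwise
      (fun s t hst y => c.antitone_dist_sub y hst) (tendsto_busemann c)
  refine mem_closure_of_tendsto (((FunModConst.continuous_mk Y).tendsto _).comp hF)
    (Eventually.of_forall fun t => ⟨c t, FunModConst.mk_eq_mk.2 ⟨-t, fun y => ?_⟩⟩)
  change dist y (c t) - t = dist (c t) y + -t
  rw [dist_comm, sub_eq_add_neg]

/-- The subray of `c` from time `a` on. -/
def GeodesicRay.shift (c : GeodesicRay X) (a : NNReal) : GeodesicRay X :=
  ⟨fun t => c (t + a), Isometry.of_dist_eq fun s t => by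
    rw [c.dist_eq, NNReal.dist_eq, NNReal.coe_add, NNReal.coe_add, add_sub_add_right_eq_sub]⟩

/-- The product of two rays, a ray for the maximum metric. -/
def GeodesicRay.prod (c : GeodesicRay X) (c' : GeodesicRay Y) : GeodesicRay (X × Y) :=
  ⟨fun t => (c t, c' t), Isometry.of_dist_eq fun s t => by
    rw [Prod.dist_eq, c.isometry_toFun.dist_eq, c'.isometry_toFun.dist_eq, max_self]⟩

theorem busemann_shift (c : GeodesicRay X) (a : NNReal) (x : X) :
    busemann (c.shift a) x = busemann c x + a := by
  refine tendsto_nhds_unique (tendsto_busemann (c.shift a) x) ?_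
  have hshift : Tendsto (fun t => t + a) atTop atTop :=
    tendsto_atTop_mono (fun _ => le_self_add) tendsto_id
  refine (((tendsto_busemann c x).comp hshift).add_const (a : ℝ)).congr fun t => ?_
  simp only [Function.comp_apply, NNReal.coe_add, GeodesicRay.shift]
  ring

theorem busemann_prod (c : GeodesicRay X) (c' : GeodesicRay Y) (z : X × Y) :
    busemann (c.prod c') z = max (busemann c z.1) (busemann c' z.2) :=
  tendsto_nhds_unique (tendsto_busemann (c.prod c') z)
    (((tendsto_busemann c z.1).max (tendsto_busemann c' z.2)).congr fun _ =>
      max_sub_sub_right _ _ _)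

@[simp]
theorem maxBusemann_apply (c c' : GeodesicRay X) (C : ℝ) (z : X × X) :
    maxBusemann c c' C z = max (busemann c z.1) (busemann c' z.2 + C) := rfl

theorem mk_maxBusemann_mem_idealDomain {c c' : GeodesicRay X} (hne : c.endpoint ≠ c'.endpoint)
    (C : ℝ) : FunModConst.mk (maxBusemann c c' C) ∈ idealDomain X := by
  refine ⟨?_, c, c', C, hne, rfl⟩
  -- Up to a constant this is the Busemann function of the ray `t ↦ (c (t + C⁻), c' (t + C⁺))`.
  convert mk_busemann_mem_horofunctionBoundary
    ((c.shift (-C).toNNReal).prod (c'.shift C.toNNReal)) using 1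
  refine FunModConst.mk_eq_mk.2 ⟨(-C).toNNReal, fun z => ?_⟩
  have hC : (C.toNNReal : ℝ) - (-C).toNNReal = C := max_zero_sub_max_neg_zero_eq_self C
  change busemann _ z = _
  rw [busemann_prod, busemann_shift, busemann_shift, maxBusemann_apply, ← max_add_add_right]
  congr 1
  linarith

end HorofunctionBoundary

/-! ### Minima on the diagonal -/

section DiagonalMinima

variable {X : Type*} [MetricSpace X]

/-- The representatives of `η`, which differ by constants, attain their minimum on the diagonal of
`X × X` at `(x, x)`. These points `x` form a coarse, equivariant projection of `Ω` to `X`. -/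
def IsDiagMin (η : FunModConst (X × X)) (x : X) : Prop :=
  ∃ f : C(X × X, ℝ), FunModConst.mk f = η ∧ ∀ y, f (x, x) ≤ f (y, y)

theorem isDiagMin_mk {f : C(X × X, ℝ)} {x : X} :
    IsDiagMin (FunModConst.mk f) x ↔ ∀ y, f (x, x) ≤ f (y, y) := by
  refine ⟨?_, fun h => ⟨f, rfl, h⟩⟩
  rintro ⟨g, hg, h⟩ y
  obtain ⟨a, ha⟩ := FunModConst.mk_eq_mk.1 hg
  rw [ha, ha]
  exact add_le_add_left (h y) a

theorem IsDiagMin.smul {η : FunModConst (X × X)} {x : X} (h : IsDiagMin η x) (γ : X ≃ᵢ X) :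
    IsDiagMin (γ • η) (γ • x) := by
  obtain ⟨f, rfl, h⟩ := h
  rw [FunModConst.smul_mk, isDiagMin_mk]
  intro y
  change f (γ⁻¹ • γ • x, γ⁻¹ • γ • x) ≤ f (γ⁻¹ • y, γ⁻¹ • y)
  rw [inv_smul_smul]
  exact h _

theorem IsCATNegOne.exists_isDiagMin [ProperSpace X] (hX : IsCATNegOne X)
    {η : FunModConst (X × X)} (hη : η ∈ idealDomain X) : ∃ x, IsDiagMin η x := by
  obtain ⟨-, c, c', C, hne, rfl⟩ := hη
  have hcont : Continuous fun x => maxBusemann c c' C (x, x) := by fun_prop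
  have : Nonempty X := ⟨c 0⟩
  obtain ⟨x, hx⟩ := hcont.exists_forall_le
    (Metric.cobounded_eq_cocompact (α := X) ▸ hX.tendsto_max_busemann_atTop hne C)
  exact ⟨x, isDiagMin_mk.2 hx⟩

theorem IsCATNegOne.busemann_le_of_forall_max_le [ProperSpace X] (hX : IsCATNegOne X)
    {c c' : GeodesicRay X} {C : ℝ} {x : X}
    (h : ∀ y, max (busemann c x) (busemann c' x + C) ≤ max (busemann c y) (busemann c' y + C)) :
    busemann c' x + C ≤ busemann c x := by
  -- Otherwise moving by half the gap towards the endpoint of `c'` lowers the maximum.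
  by_contra! hlt
  obtain ⟨r, hr_zero, hr⟩ := hX.exists_busemann_eq_sub c' x
  set t : NNReal := ((busemann c' x + C - busemann c x) / 2).toNNReal
  have ht : (t : ℝ) = (busemann c' x + C - busemann c x) / 2 :=
    Real.coe_toNNReal _ (by linarith)
  have hc' : busemann c' (r t) = busemann c' x - t := by
    linarith [hr (r t), busemann_apply r t]
  have hc : busemann c (r t) ≤ busemann c x + t := by
    have hle := busemann_le_add_dist c (r t) x
    rwa [dist_comm, ← hr_zero, r.dist_zero, hr_zero] at hle
  rcases le_max_iff.1 ((le_max_right _ _).trans (h (r t))) with hle | hle <;> linarith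

theorem IsCATNegOne.busemann_eq_of_isDiagMin [ProperSpace X] (hX : IsCATNegOne X)
    {c c' : GeodesicRay X} {C : ℝ} {x : X}
    (h : IsDiagMin (FunModConst.mk (maxBusemann c c' C)) x) :
    busemann c x = busemann c' x + C := by
  rw [isDiagMin_mk] at h
  refine le_antisymm ?_ (hX.busemann_le_of_forall_max_le h)
  have hswap : ∀ y, max (busemann c' y) (busemann c y + -C) =
      maxBusemann c c' C (y, y) + -C := fun y => by
    rw [maxBusemann_apply, max_comm, ← max_add_add_right, add_neg_cancel_right]
  have hle := hX.busemann_le_of_forall_max_le (c := c') (c' := c) (C := -C) (x := x) fun y => by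
    rw [hswap, hswap]
    exact add_le_add_left (h y) (-C)
  linarith

theorem IsCATNegOne.exists_mk_maxBusemann_eq [ProperSpace X] (hX : IsCATNegOne X)
    (c c' : GeodesicRay X) (C : ℝ) (o : X) :
    ∃ (r r' : GeodesicRay X) (D : ℝ), r 0 = o ∧ r' 0 = o ∧
      FunModConst.mk (maxBusemann c c' C) = FunModConst.mk (maxBusemann r r' D) := by
  obtain ⟨r, hr_zero, hr⟩ := hX.exists_busemann_eq_sub c o
  obtain ⟨r', hr'_zero, hr'⟩ := hX.exists_busemann_eq_sub c' o
  refine ⟨r, r', busemann c' o + C - busemann c o, hr_zero, hr'_zero,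
    FunModConst.mk_eq_mk.2 ⟨-busemann c o, fun z => ?_⟩⟩
  rw [maxBusemann_apply, maxBusemann_apply, hr, hr', ← max_add_add_right]
  congr 1
  ring

end DiagonalMinima

/-! ### Compactness -/

section Compactness

variable {X : Type*} [MetricSpace X]

theorem isClosed_isometry {Y Z : Type*} [PseudoMetricSpace Y] [PseudoMetricSpace Z] :
    IsClosed {f : Y → Z | Isometry f} := by
  simp only [isometry_iff_dist_eq, ofPred_forall]
  exact isClosed_iInter fun y => isClosed_iInter fun y' =>
    isClosed_eq ((continuous_apply y).dist (continuous_apply y')) continuous_const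

theorem isCompact_isometry {Y : Type*} [PseudoMetricSpace Y] [ProperSpace X] (o : Y) {K : Set X}
    (hK : IsCompact K) : IsCompact {f : Y → X | Isometry f ∧ f o ∈ K} := by
  refine (isCompact_univ_pi fun y => hK.cthickening (r := dist y o)).of_isClosed_subset
    (isClosed_isometry.inter (hK.isClosed.preimage (continuous_apply o))) ?_
  rintro f ⟨hf, ho⟩ y -
  exact Metric.mem_cthickening_of_dist_le _ _ _ _ ho (hf.dist_eq y o).le

/-- The rays from `o`, with the topology of pointwise convergence. -/
abbrev RayFrom (o : X) : Type _ := {f : NNReal → X // Isometry f ∧ f 0 = o}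

/-- A ray from `o`, as a `GeodesicRay`. -/
def RayFrom.toRay {o : X} (c : RayFrom o) : GeodesicRay X := ⟨c.1, c.2.1⟩

instance [ProperSpace X] (o : X) : CompactSpace (RayFrom o) :=
  isCompact_iff_compactSpace.1 (isCompact_isometry 0 isCompact_singleton)

theorem continuous_toRay_apply (o : X) (s : NNReal) :
    Continuous fun c : RayFrom o => c.toRay s :=
  (continuous_apply s).comp continuous_subtype_val

theorem IsCATNegOne.continuous_busemann_toRay (hX : IsCATNegOne X) (o z : X) :
    Continuous fun c : RayFrom o => busemann c.toRay z := by
  have hunif : TendstoUniformly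
      (fun (s : NNReal) (c : RayFrom o) => Real.exp (dist z (c.toRay s) - s))
      (fun c => Real.exp (busemann c.toRay z)) atTop := by
    rw [Metric.tendstoUniformly_iff]
    intro ε hε
    filter_upwards [(tendsto_two_mul_exp_neg_two_mul (Real.cosh (dist z o))).eventually_lt_const hε]
      with s hs c
    have hle := Real.exp_le_exp.2 (busemann_le_dist_sub c.toRay z s)
    have hge := hX.exp_dist_sub_le c.toRay z s
    rw [show c.toRay 0 = o from c.2.2] at hge
    rw [dist_comm, Real.dist_eq]
    exact abs_lt.2 ⟨by linarith, by linarith⟩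
  have hexp : Continuous fun c : RayFrom o => Real.exp (busemann c.toRay z) :=
    hunif.continuous (Frequently.of_forall fun s => Real.continuous_exp.comp
      ((continuous_const.dist (continuous_toRay_apply o s)).sub continuous_const))
  exact (hexp.log fun c => Real.exp_ne_zero _).congr fun c => Real.log_exp _

theorem IsCATNegOne.continuous_busemann_toRay_uncurry (hX : IsCATNegOne X) (o : X) :
    Continuous fun p : RayFrom o × X => busemann p.1.toRay p.2 :=
  continuous_prod_of_continuous_lipschitzWith' _ 1
    (fun c => LipschitzWith.of_le_add (busemann_le_add_dist c.toRay))
    (hX.continuous_busemann_toRay o)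

theorem IsCATNegOne.continuous_maxBusemann_toRay (hX : IsCATNegOne X) (o : X) :
    Continuous fun q : RayFrom o × RayFrom o × ℝ => maxBusemann q.1.toRay q.2.1.toRay q.2.2 := by
  refine ContinuousMap.continuous_of_continuous_uncurry _ ?_
  have hβ := hX.continuous_busemann_toRay_uncurry o
  exact (hβ.comp (by fun_prop : Continuous fun p : (RayFrom o × RayFrom o × ℝ) × X × X =>
      (p.1.1, p.2.1))).max
    ((hβ.comp (by fun_prop : Continuous fun p : (RayFrom o × RayFrom o × ℝ) × X × X =>
      (p.1.2.1, p.2.2))).add (by fun_prop))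

theorem isClosed_forall_apply_diag_le [LocallyCompactSpace X] :
    IsClosed {p : C(X × X, ℝ) × X | ∀ y, p.1 (p.2, p.2) ≤ p.1 (y, y)} := by
  rw [ofPred_forall]
  exact isClosed_iInter fun y => isClosed_le (by fun_prop) (by fun_prop)

theorem IsCATNegOne.abs_le_two_mul_dist_of_isDiagMin [ProperSpace X] (hX : IsCATNegOne X)
    {r r' : GeodesicRay X} {o x : X} (hr : r 0 = o) (hr' : r' 0 = o) {D : ℝ}
    (h : IsDiagMin (FunModConst.mk (maxBusemann r r' D)) x) : |D| ≤ 2 * dist x o := by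
  have hD := hX.busemann_eq_of_isDiagMin h
  have hβ := abs_le.1 (abs_busemann_sub_le r x o)
  have hβ' := abs_le.1 (abs_busemann_sub_le r' x o)
  rw [← hr, busemann_apply_zero, hr] at hβ
  rw [← hr', busemann_apply_zero, hr'] at hβ'
  exact abs_le.2 ⟨by linarith, by linarith⟩

theorem IsCATNegOne.isCompact_exists_isDiagMin [ProperSpace X] (hX : IsCATNegOne X) {K : Set X}
    (hK : IsCompact K) :
    IsCompact {η : idealDomain X | ∃ x ∈ K, IsDiagMin (η : FunModConst (X × X)) x} := by
  rcases K.eq_empty_or_nonempty with rfl | ⟨o, -⟩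
  · simp
  obtain ⟨R, hR⟩ := hK.isBounded.subset_closedBall o
  let F : (RayFrom o × RayFrom o × ℝ) × X → C(X × X, ℝ) × X :=
    Prod.map (fun q => maxBusemann q.1.toRay q.2.1.toRay q.2.2) id
  have hF : Continuous F := (hX.continuous_maxBusemann_toRay o).prodMap continuous_id
  have hcompact : IsCompact ((univ ×ˢ univ ×ˢ Metric.closedBall (0 : ℝ) (2 * R)) ×ˢ K ∩
      F ⁻¹' {p | ∀ y, p.1 (p.2, p.2) ≤ p.1 (y, y)}) :=
    ((isCompact_univ.prod (isCompact_univ.prod (isCompact_closedBall 0 _))).prod hK).inter_right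
      (isClosed_forall_apply_diag_le.preimage hF)
  rw [Subtype.isCompact_iff]
  convert hcompact.image ((FunModConst.continuous_mk _).comp (continuous_fst.comp hF)) using 1
  ext η
  constructor
  · rintro ⟨⟨η, _, c, c', C, _, rfl⟩, ⟨x, hx, hmin⟩, rfl⟩
    obtain ⟨r, r', D, hr, hr', heq⟩ := hX.exists_mk_maxBusemann_eq c c' C o
    change IsDiagMin (FunModConst.mk (maxBusemann c c' C)) x at hmin
    rw [heq] at hmin
    have hD : D ∈ Metric.closedBall (0 : ℝ) (2 * R) := by
      rw [mem_closedBall_zero_iff, Real.norm_eq_abs]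
      linarith [hX.abs_le_two_mul_dist_of_isDiagMin hr hr' hmin, Metric.mem_closedBall.1 (hR hx)]
    exact ⟨((⟨r.1, r.2, hr⟩, ⟨r'.1, r'.2, hr'⟩, D), x),
      ⟨⟨⟨mem_univ _, mem_univ _, hD⟩, hx⟩, isDiagMin_mk.1 hmin⟩, heq.symm⟩
  · rintro ⟨⟨⟨r, r', D⟩, x⟩, ⟨⟨-, hx⟩, hmin⟩, rfl⟩
    exact ⟨⟨_, mk_maxBusemann_mem_idealDomain (endpoint_ne_of_le_max hmin) D⟩,
      ⟨x, hx, isDiagMin_mk.2 hmin⟩, rfl⟩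

theorem IsCATNegOne.isCocompactAction_idealDomain [ProperSpace X] (hX : IsCATNegOne X)
    (Γ : Subgroup (X ≃ᵢ X)) (hcoc : IsCocompactAction Γ X) :
    IsCocompactAction Γ (idealDomain X) := by
  obtain ⟨K, hK, hKX⟩ := hcoc
  refine ⟨_, hX.isCompact_exists_isDiagMin hK, fun η => ?_⟩
  obtain ⟨x, hx⟩ := hX.exists_isDiagMin η.2
  obtain ⟨γ, y, hy, rfl⟩ := hKX x
  refine ⟨γ, γ⁻¹ • η, ⟨y, hy, ?_⟩, smul_inv_smul γ η⟩
  have h := hx.smul (γ : X ≃ᵢ X)⁻¹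
  rwa [Subgroup.smul_def γ y, inv_smul_smul] at h

end Compactness

/-! ### Proper discontinuity -/

section ProperDiscontinuity

variable {X : Type*} [MetricSpace X]

theorem IsCATNegOne.geodesicallyQuasiconvex_diag (hX : IsCATNegOne X) {f : C(X × X, ℝ)}
    (hf : FunModConst.mk f ∈ idealDomain X) : GeodesicallyQuasiconvex fun x => f (x, x) := by
  obtain ⟨-, c, c', C, -, heq⟩ := hf
  obtain ⟨a, ha⟩ := FunModConst.mk_eq_mk.1 heq.symm
  simp only [ha]
  exact ((hX.geodesicallyQuasiconvex_busemann c).max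
    ((hX.geodesicallyQuasiconvex_busemann c').add_const C)).add_const a

theorem exists_forall_sphere_lt {h : X → ℝ} (hh : Tendsto h (Bornology.cobounded X) atTop)
    (x₀ : X) (M : ℝ) : ∃ R : ℝ, 0 ≤ R ∧ ∀ m ∈ Metric.sphere x₀ R, M < h m := by
  obtain ⟨r, -, hr⟩ := (Metric.hasBasis_cobounded_compl_closedBall x₀).eventually_iff.1
    (hh.eventually_gt_atTop M)
  refine ⟨max (r + 1) 0, le_max_right _ _, fun m hm => hr ?_⟩
  rw [mem_compl_iff, Metric.mem_closedBall, Metric.mem_sphere.1 hm, not_le]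
  exact (lt_add_one r).trans_le (le_max_left _ _)

theorem eventually_forall_sphere_lt [ProperSpace X] {f₀ : C(X × X, ℝ)} {x₀ : X} {R : ℝ}
    (h : ∀ m ∈ Metric.sphere x₀ R, f₀ (x₀, x₀) < f₀ (m, m)) :
    ∀ᶠ f in 𝓝 f₀, ∀ m ∈ Metric.sphere x₀ R, f (x₀, x₀) < f (m, m) := by
  refine (isCompact_sphere x₀ R).eventually_forall_of_forall_eventually fun m hm => ?_
  have hopen : IsOpen {p : C(X × X, ℝ) × X | p.1 (x₀, x₀) < p.1 (p.2, p.2)} :=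
    isOpen_lt (by fun_prop) (by fun_prop)
  exact hopen.mem_nhds (h m hm)

theorem IsCATNegOne.exists_mem_nhds_isBounded_isDiagMin [ProperSpace X] (hX : IsCATNegOne X)
    (η₀ : idealDomain X) : ∃ V ∈ 𝓝 η₀,
      Bornology.IsBounded {x : X | ∃ η ∈ V, IsDiagMin (η : FunModConst (X × X)) x} := by
  obtain ⟨-, c, c', C, hne, hη₀⟩ := η₀.2
  obtain ⟨R, hR, hsphere⟩ := exists_forall_sphere_lt (hX.tendsto_max_busemann_atTop hne C) (c 0)
    (maxBusemann c c' C (c 0, c 0))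
  refine ⟨Subtype.val ⁻¹' (FunModConst.mk ''
    {f | ∀ m ∈ Metric.sphere (c 0) R, f (c 0, c 0) < f (m, m)}), ?_, ?_⟩
  · refine continuous_subtype_val.continuousAt ?_
    rw [hη₀]
    exact (FunModConst.isOpenMap_mk _).image_mem_nhds (eventually_forall_sphere_lt hsphere)
  · refine Metric.isBounded_closedBall.subset (t := Metric.closedBall (c 0) R) ?_
    rintro x ⟨⟨_, hη⟩, ⟨f, hf, rfl⟩, hx⟩
    by_contra hfar
    rw [Metric.mem_closedBall', not_le] at hfar
    have hlt := (hX.geodesicallyQuasiconvex_diag hη).lt_of_forall_sphere_lt hX.exists_segment hR hf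
      hfar.le
    exact (isDiagMin_mk.1 hx (c 0)).not_gt hlt

theorem IsCATNegOne.isBounded_exists_isDiagMin [ProperSpace X] (hX : IsCATNegOne X)
    {K : Set (idealDomain X)} (hK : IsCompact K) :
    Bornology.IsBounded {x : X | ∃ η ∈ K, IsDiagMin (η : FunModConst (X × X)) x} := by
  refine hK.induction_on (p := fun s => Bornology.IsBounded
    {x : X | ∃ η ∈ s, IsDiagMin (η : FunModConst (X × X)) x}) (by simp) ?_ ?_ fun η₀ _ => ?_
  · exact fun s t hst ht => ht.subset fun x ⟨η, hη, h⟩ => ⟨η, hst hη, h⟩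
  · refine fun s t hs ht => (hs.union ht).subset ?_
    rintro x ⟨η, hη | hη, h⟩
    exacts [Or.inl ⟨η, hη, h⟩, Or.inr ⟨η, hη, h⟩]
  · obtain ⟨V, hV, hbounded⟩ := hX.exists_mem_nhds_isBounded_isDiagMin η₀
    exact ⟨V, mem_nhdsWithin_of_mem_nhds hV, hbounded⟩

theorem eventually_forall_dist_lt {Y : Type*} [TopologicalSpace Y] (f : C(Y, X)) {K : Set Y}
    (hK : IsCompact K) {ε : ℝ} (hε : 0 < ε) : ∀ᶠ g in 𝓝 f, ∀ y ∈ K, dist (f y) (g y) < ε :=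
  Metric.tendstoUniformlyOn_iff.1
    (ContinuousMap.tendsto_iff_forall_isCompact_tendstoUniformlyOn.1 tendsto_id K hK) ε hε

theorem IsDiscreteSubgroup.exists_forall_eq {Γ : Subgroup (X ≃ᵢ X)} (hΓ : IsDiscreteSubgroup Γ) :
    ∃ K : Set X, IsCompact K ∧ ∃ ε > 0, ∀ γ γ' : Γ,
      (∀ x ∈ K, dist (γ • x) (γ' • x) < ε) → γ = γ' := by
  obtain ⟨U, hU, hU_one⟩ := isOpen_induced_iff.1 (@isOpen_discrete Γ (_) hΓ {1})
  have hid : ContinuousMap.id X ∈ U := by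
    have hone : (1 : Γ) ∈ ({1} : Set Γ) := rfl
    rwa [← hU_one] at hone
  obtain ⟨⟨K, ε⟩, ⟨hK, hε⟩, hsub⟩ := (nhds_basis_uniformity'
    Metric.uniformity_basis_dist.compactConvergenceUniformity).mem_iff.1 (hU.mem_nhds hid)
  refine ⟨K, hK, ε, hε, fun γ γ' h => inv_mul_eq_one.1 ?_⟩
  rw [← mem_singleton_iff, ← hU_one]
  refine hsub fun x hx => ?_
  change dist x ((γ⁻¹ * γ') • x) < ε
  rw [mul_smul, ← dist_smul (γ : X ≃ᵢ X), ← Subgroup.smul_def, ← Subgroup.smul_def, smul_inv_smul]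
  exact h x hx

theorem isCompact_continuousMap_isometry {Y : Type*} [PseudoMetricSpace Y] [ProperSpace X] (o : Y)
    {K : Set X} (hK : IsCompact K) : IsCompact {f : C(Y, X) | Isometry f ∧ f o ∈ K} := by
  refine ArzelaAscoli.isCompact_of_equicontinuous _ ?_
    (LipschitzWith.uniformEquicontinuous _ 1 fun f => f.2.1.lipschitz).equicontinuous
  convert isCompact_isometry o hK using 1
  ext f
  exact ⟨fun ⟨_, hg, hgf⟩ => hgf ▸ hg, fun hf => ⟨⟨f, hf.1.continuous⟩, hf, rfl⟩⟩

theorem IsDiscreteSubgroup.finite_of_isCompact {Γ : Subgroup (X ≃ᵢ X)} (hΓ : IsDiscreteSubgroup Γ)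
    {S : Set C(X, X)} (hS : IsCompact S) :
    {γ : Γ | (⟨γ.1, γ.1.continuous⟩ : C(X, X)) ∈ S}.Finite := by
  obtain ⟨K, hK, ε, hε, heq⟩ := hΓ.exists_forall_eq
  refine hS.induction_on (p := fun s => {γ : Γ | (⟨γ.1, γ.1.continuous⟩ : C(X, X)) ∈ s}.Finite)
    (by simp) ?_ ?_ fun f _ => ?_
  · exact fun s t hst ht => ht.subset fun γ hγ => hst hγ
  · exact fun s t hs ht => hs.union ht
  · refine ⟨_, mem_nhdsWithin_of_mem_nhds (eventually_forall_dist_lt f hK (half_pos hε)),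
      Set.Subsingleton.finite fun γ hγ γ' hγ' => heq γ γ' fun x hx => ?_⟩
    calc dist (γ • x) (γ' • x) ≤ dist (f x) (γ • x) + dist (f x) (γ' • x) :=
          dist_triangle_left _ _ _
      _ < ε / 2 + ε / 2 := add_lt_add (hγ x hx) (hγ' x hx)
      _ = ε := add_halves ε

theorem IsDiscreteSubgroup.finite_exists_smul_mem [ProperSpace X] {Γ : Subgroup (X ≃ᵢ X)}
    (hΓ : IsDiscreteSubgroup Γ) {A B : Set X} (hA : Bornology.IsBounded A)
    (hB : Bornology.IsBounded B) : {γ : Γ | ∃ x ∈ A, γ • x ∈ B}.Finite := by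
  rcases A.eq_empty_or_nonempty with rfl | ⟨o, -⟩
  · simp
  obtain ⟨R, hR⟩ := hA.subset_closedBall o
  refine (hΓ.finite_of_isCompact (isCompact_continuousMap_isometry o
    (hB.isCompact_closure.cthickening (r := R)))).subset ?_
  rintro γ ⟨x, hx, hγx⟩
  refine ⟨γ.1.isometry, Metric.mem_cthickening_of_dist_le _ (γ • x) _ _ (subset_closure hγx) ?_⟩
  change dist (γ.1 • o) (γ.1 • x) ≤ R
  rw [dist_smul, ← Metric.mem_closedBall']
  exact hR hx

theorem IsCATNegOne.properlyDiscontinuousSMul_idealDomain [ProperSpace X] (hX : IsCATNegOne X)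
    {Γ : Subgroup (X ≃ᵢ X)} (hΓ : IsDiscreteSubgroup Γ) :
    ProperlyDiscontinuousSMul Γ (idealDomain X) where
  finite_disjoint_inter_image hK hL := by
    refine (hΓ.finite_exists_smul_mem (hX.isBounded_exists_isDiagMin hK)
      (hX.isBounded_exists_isDiagMin hL)).subset ?_
    rintro γ ⟨_, ⟨η, hη, rfl⟩, hγη⟩
    obtain ⟨x, hx⟩ := hX.exists_isDiagMin η.2
    exact ⟨x, ⟨η, hη, hx⟩, γ • η, hγη, hx.smul (γ : X ≃ᵢ X)⟩

end ProperDiscontinuity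

theorem mainTheorem8 {X : Type*} [MetricSpace X] [ProperSpace X] [NoncompactSpace X]
    (hX : IsCATNegOne X) (Γ : Subgroup (X ≃ᵢ X)) (hdisc : IsDiscreteSubgroup Γ)
    (hcoc : IsCocompactAction Γ X) :
    IsCocompactAction Γ (idealDomain X) ∧ ProperlyDiscontinuousSMul Γ (idealDomain X) :=
  ⟨hX.isCocompactAction_idealDomain Γ hcoc, hX.properlyDiscontinuousSMul_idealDomain hdisc⟩
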